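/- Let $\mathbb{A}$ be one of $\mathbb{R},\mathbb{C},\mathbb{H},\mathbb{O}$, where $\mathbb{O}=\mathbb{H}\oplus\mathbb{H}$ has the Cayley--Dickson product $(a,b)(c,d)=(ac-d\bar b,\ \bar a d+cb)$, and let $\mathbb{A}^n$ carry its Euclidean norm and its coordinatewise right multiplication by $\mathbb{A}$; for $\mathbb{A}=\mathbb{H}$ let $n\ge 1$, and for $\mathbb{A}=\mathbb{O}$ let $n=1$. A real linear isometry $\phi$ of $\mathbb{A}^n$ is a *twisted isomorphism* if there is $\theta\in SO(\mathbb{A})$ with $\phi(vx)=\phi(v)\theta(x)$ for all $v\in\mathbb{A}^n$, $x\in\mathbb{A}$; these form a group $G_{\mathbb{A}}(n)$. Define a representation $\lambda_{\mathbb{A}}$ of $G_{\mathbb{A}}(n)$ on $\mathbb{A}$ (projective, with values in $O(\mathbb{H})/\{\pm1\}$, if $\mathbb{A}=\mathbb{H}$) by - $\lambda_{\mathbb{R}}(g)(x)=x\det g$; - $\lambda_{\mathbb{C}}(g)(x)=x\det_{\mathbb{C}}g$ (each $g\in G_{\mathbb{C}}(n)$ is complex linear); - $\lambda_{\mathbb{H}}(g)(x)=x\beta$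 up to sign, where $g(v)=\alpha(v)\beta$ with $\alpha$ a right $\mathbb{H}$-linear isometry of $\mathbb{H}^n$ and $\beta$ a unit quaternion (such a pair $(\alpha,\beta)$ exists and is unique up to a common sign); - $\lambda_{\mathbb{O}}(g)(x)=g(x)$. Let $H_{\mathbb{A}}(n)\subset G_{\mathbb{A}}(n)$ be the subgroup of the $g$ such that $\lambda_{\mathbb{A}}(g)$ fixes $1\in\mathbb{A}$ (for $\mathbb{A}=\mathbb{H}$: such that some representative of $\lambda_{\mathbb{H}}(g)$ in $O(\mathbb{H})$ fixes $1$). Then, as groups of transformations of $\mathbb{A}^n$, $$H_{\mathbb{R}}(n)=SO(n),\qquad H_{\mathbb{C}}(n)=SU(n),\qquad H_{\mathbb{H}}(n)=Sp(n),\qquad H_{\mathbb{O}}(1)=G_2 .$$ Here $SO(n)$, $SU(n)$ and the group $Sp(n)$ of $n\times n$ quaternionic matrices $A$ with $A^*A=AA^*=1$ act on column vectors by $v\mapsto Av$, and $G_2$ is the group of automorphisms of the real algebra $\mathbb{O}$. -/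

import Mathlib

open scoped Quaternion RightActions

noncomputable section

namespace NormedDivAlg

/-! ### Twisted isomorphisms

`A` is a normed algebra, `V` a normed linear `A`-space.  The right multiplication `v x` is the
Mathlib action of the opposite, written `v <• x`; on `A` itself it is `v * x`, on `Aⁿ` it is
coordinatewise. -/

section Twisted

variable (A : Type*) [NormedAddCommGroup A] [NormedSpace ℝ A]
variable (V : Type*) [NormedAddCommGroup V] [NormedSpace ℝ V] [SMul Aᵐᵒᵖ V]

/-- The group of twisted isomorphisms of `V`: the real linear isometries `φ` of `V` such that
`φ (v x) = φ v * θ x` for some `θ ∈ SO(A)`. -/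
def twistedIso : Subgroup (V ≃ₗᵢ[ℝ] V) where
  carrier := {φ | ∃ θ : A ≃ₗᵢ[ℝ] A, LinearMap.det (θ.toLinearEquiv : A →ₗ[ℝ] A) = 1 ∧
    ∀ (v : V) (x : A), φ (v <• x) = φ v <• θ x}
  one_mem' := by
    refine ⟨1, ?_, fun v x => rfl⟩
    exact LinearMap.det_id
  mul_mem' := by
    rintro φ ψ ⟨θ, hθ, h⟩ ⟨η, hη, k⟩
    refine ⟨θ * η, ?_, fun v x => ?_⟩
    · have : (((θ * η).toLinearEquiv : A ≃ₗ[ℝ] A) : A →ₗ[ℝ] A) =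
          (θ.toLinearEquiv : A →ₗ[ℝ] A) ∘ₗ (η.toLinearEquiv : A →ₗ[ℝ] A) := rfl
      rw [this, LinearMap.det_comp, hθ, hη, one_mul]
    · change φ (ψ (v <• x)) = φ (ψ v) <• θ (η x)
      rw [k, h]
  inv_mem' := by
    rintro φ ⟨θ, hθ, h⟩
    refine ⟨θ⁻¹, ?_, fun v x => ?_⟩
    · have h1 : (θ.toLinearEquiv : A →ₗ[ℝ] A) ∘ₗ ((θ⁻¹).toLinearEquiv : A →ₗ[ℝ] A) =
          LinearMap.id := by
        ext x
        exact θ.apply_symm_apply x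
      have h2 := congrArg LinearMap.det h1
      rwa [LinearMap.det_comp, hθ, one_mul, LinearMap.det_id] at h2
    · change φ.symm (v <• x) = φ.symm v <• θ.symm x
      rw [LinearIsometryEquiv.symm_apply_eq, h]
      simp

/-- The group of automorphisms of `V`: the real linear isometries `φ` with `φ (v x) = φ v x`. -/
def autGroup : Subgroup (V ≃ₗᵢ[ℝ] V) where
  carrier := {φ | ∀ (v : V) (x : A), φ (v <• x) = φ v <• x}
  one_mem' := fun _ _ => rfl
  mul_mem' := by
    intro φ ψ h k v x
    change φ (ψ (v <• x)) = φ (ψ v) <• x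
    rw [k, h]
  inv_mem' := by
    intro φ h v x
    change φ.symm (v <• x) = φ.symm v <• x
    rw [LinearIsometryEquiv.symm_apply_eq, h]
    simp

end Twisted

/-- `Aⁿ` with the Euclidean norm. -/
abbrev Space (A : Type*) (n : ℕ) : Type _ := PiLp 2 (fun _ : Fin n => A)

/-- The group of twisted isomorphisms of `Aⁿ`. -/
abbrev G (A : Type*) [NormedAddCommGroup A] [NormedSpace ℝ A] [Mul A] (n : ℕ) :
    Subgroup (Space A n ≃ₗᵢ[ℝ] Space A n) :=
  twistedIso A (Space A n)

/-- Given an orthogonal representation `ρ` on `A`, the subgroup of elements fixing `1 ∈ A`. -/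
def stabOne {A : Type*} [NormedAddCommGroup A] [NormedSpace ℝ A] [One A]
    {Γ : Type*} [Group Γ] (ρ : Γ →* (A ≃ₗᵢ[ℝ] A)) : Subgroup Γ where
  carrier := {g | ρ g 1 = 1}
  one_mem' := by simp
  mul_mem' := by
    intro a b (ha : ρ a 1 = 1) (hb : ρ b 1 = 1)
    simp [ha, hb]
  inv_mem' := by
    intro a (ha : ρ a 1 = 1)
    change ρ a⁻¹ 1 = 1
    rw [map_inv]
    change (ρ a).symm 1 = 1
    rw [LinearIsometryEquiv.symm_apply_eq, ha]

/-- Right multiplication `x ↦ x u` by a unit vector `u`, as an isometry. -/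
def mulRight {A : Type*} [NormedDivisionRing A] [NormedAlgebra ℝ A]
    (u : Metric.sphere (0 : A) 1) : A ≃ₗᵢ[ℝ] A where
  toFun x := x * u
  invFun x := x * (u : A)⁻¹
  map_add' x y := add_mul x y _
  map_smul' r x := smul_mul_assoc r x _
  left_inv x := by
    have : (u : A) ≠ 0 := ne_zero_of_mem_unit_sphere u
    simp [this]
  right_inv x := by
    have : (u : A) ≠ 0 := ne_zero_of_mem_unit_sphere u
    simp [this]
  norm_map' x := by
    change ‖x * (u : A)‖ = ‖x‖
    simp

theorem mulRight_apply {A : Type*} [NormedDivisionRing A] [NormedAlgebra ℝ A]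
    (u : Metric.sphere (0 : A) 1) (x : A) : mulRight u x = x * u := rfl

/-! ### The real case -/

theorem norm_det_eq_one {𝕜 E : Type*} [RCLike 𝕜] [NormedAddCommGroup E] [InnerProductSpace 𝕜 E]
    [FiniteDimensional 𝕜 E] (f : E →ₗ[𝕜] E) (hf : ∀ x, ‖f x‖ = ‖x‖) :
    LinearMap.det f ∈ Metric.sphere (0 : 𝕜) 1 := by
  have := LinearIsometry.normDet_eq_one (⟨f, hf⟩ : E →ₗᵢ[𝕜] E)
  rw [LinearMap.normDet_eq_norm_det] at this
  simpa using this

/-- `λ_ℝ(g)(x) = x det g`. -/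
def lambdaR (n : ℕ) : G ℝ n →* (ℝ ≃ₗᵢ[ℝ] ℝ) where
  toFun g := mulRight ⟨LinearMap.det
    ((g : Space ℝ n ≃ₗᵢ[ℝ] Space ℝ n).toLinearEquiv : Space ℝ n →ₗ[ℝ] Space ℝ n),
    norm_det_eq_one _ fun x => (g : Space ℝ n ≃ₗᵢ[ℝ] Space ℝ n).norm_map x⟩
  map_one' := by
    ext x
    simp only [mulRight_apply]
    exact (congrArg (x * ·) LinearMap.det_id).trans (mul_one x)
  map_mul' g h := by
    ext x
    change x * LinearMap.det (_ ∘ₗ _) = x * LinearMap.det _ * LinearMap.det _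
    rw [LinearMap.det_comp, mul_assoc, mul_comm (LinearMap.det _)]

/-- The group of special twisted isomorphisms of `ℝⁿ`. -/
def HR (n : ℕ) : Subgroup (G ℝ n) := stabOne (lambdaR n)

/-! ### The complex case -/

theorem map_smul_complex {n : ℕ} (g : G ℂ n) (c : ℂ) (v : Space ℂ n) :
    (g : Space ℂ n ≃ₗᵢ[ℝ] Space ℂ n) (c • v) = c • (g : Space ℂ n ≃ₗᵢ[ℝ] Space ℂ n) v := by
  obtain ⟨φ, θ, hθ, h⟩ := g
  change φ (c • v) = c • φ v
  have hop : ∀ (w : Space ℂ n) (x : ℂ), w <• x = x • w := fun w x => by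
    ext i
    simp [mul_comm]
  simp only [hop] at h
  by_cases hv : φ v = 0
  · have hv0 : v = 0 := by simpa using hv
    simp [hv0]
  have h1 : θ 1 = 1 := by
    have := h v 1
    rw [one_smul] at this
    have h2 : (1 - θ 1) • φ v = 0 := by rw [sub_smul, one_smul, ← this, sub_self]
    rcases smul_eq_zero.1 h2 with h3 | h3
    · exact (sub_eq_zero.1 h3).symm
    · exact absurd h3 hv
  rw [h]
  rcases linear_isometry_complex_aux h1 with rfl | rfl
  · rfl
  · rw [Complex.det_conjLIE] at hθ
    norm_num at hθ

/-- A twisted isomorphism of `ℂⁿ` as a complex linear map. -/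
def toComplexLinear {n : ℕ} (g : G ℂ n) : Space ℂ n →ₗ[ℂ] Space ℂ n where
  toFun v := (g : Space ℂ n ≃ₗᵢ[ℝ] Space ℂ n) v
  map_add' v w := map_add _ v w
  map_smul' c v := map_smul_complex g c v

/-- `λ_ℂ(g)(x) = x det_ℂ g`. -/
def lambdaC (n : ℕ) : G ℂ n →* (ℂ ≃ₗᵢ[ℝ] ℂ) where
  toFun g := mulRight ⟨LinearMap.det (toComplexLinear g),
    norm_det_eq_one _ fun x => (g : Space ℂ n ≃ₗᵢ[ℝ] Space ℂ n).norm_map x⟩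
  map_one' := by
    ext x
    simp only [mulRight_apply]
    exact (congrArg (x * ·) LinearMap.det_id).trans (mul_one x)
  map_mul' g h := by
    ext x
    change x * LinearMap.det (toComplexLinear g ∘ₗ toComplexLinear h) =
      x * LinearMap.det (toComplexLinear h) * LinearMap.det (toComplexLinear g)
    rw [LinearMap.det_comp, mul_assoc, mul_comm (LinearMap.det _)]

/-- The group of special twisted isomorphisms of `ℂⁿ`. -/
def HC (n : ℕ) : Subgroup (G ℂ n) := stabOne (lambdaC n)

/-! ### The quaternionic case -/

/-- The compact symplectic group `Sp(n)` of quaternionic unitary matrices. -/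
abbrev Sp (n : ℕ) : Submonoid (Matrix (Fin n) (Fin n) ℍ) := unitary (Matrix (Fin n) (Fin n) ℍ)

/-- The subgroup `{1, -1}` of `O(ℍ)`. -/
def signs : Subgroup (ℍ ≃ₗᵢ[ℝ] ℍ) where
  carrier := {L | L = 1 ∨ L = LinearIsometryEquiv.neg ℝ}
  one_mem' := Or.inl rfl
  mul_mem' := by
    rintro a b (rfl | rfl) (rfl | rfl)
    · exact Or.inl rfl
    · exact Or.inr rfl
    · exact Or.inr rfl
    · exact Or.inl (LinearIsometryEquiv.ext fun x => neg_neg x)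
  inv_mem' := by
    rintro a (rfl | rfl)
    · exact Or.inl rfl
    · exact Or.inr rfl

instance : signs.Normal where
  conj_mem := by
    rintro L (rfl | rfl) M
    · exact Or.inl (by simp)
    · refine Or.inr (LinearIsometryEquiv.ext fun x => ?_)
      change M (-(M.symm x)) = -x
      simp

/-- `g = (α, β) ∈ Sp(n) Sp(1)`: the decomposition `g(v) = α(v) β` of `g` into an automorphism `α`
of `ℍⁿ` and a unit quaternion `β`.  The pair `(α, β)` is unique up to a common sign. -/
def HasSpFactor {n : ℕ} (g : Space ℍ n ≃ₗᵢ[ℝ] Space ℍ n) (β : Metric.sphere (0 : ℍ) 1) : Prop :=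
  ∃ α ∈ autGroup ℍ (Space ℍ n), ∀ v, g v = α v <• (β : ℍ)

theorem exists_intertwiner (θ : ℍ → ℍ) (hadd : ∀ x y, θ (x + y) = θ x + θ y)
    (hsmul : ∀ (r : ℝ) x, θ (r • x) = r • θ x) (h1 : θ 1 = 1)
    (hmul : ∀ x y, θ (x * y) = θ x * θ y) :
    ∃ q : ℍ, q ≠ 0 ∧ ∀ x, θ x * q = q * x := by
  obtain ⟨i, i0, i1, i2, i3⟩ : ∃ i : ℍ, i.re = 0 ∧ i.imI = 1 ∧ i.imJ = 0 ∧ i.imK = 0 :=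
    ⟨⟨0, 1, 0, 0⟩, rfl, rfl, rfl, rfl⟩
  obtain ⟨j, j0, j1, j2, j3⟩ : ∃ j : ℍ, j.re = 0 ∧ j.imI = 0 ∧ j.imJ = 1 ∧ j.imK = 0 :=
    ⟨⟨0, 0, 1, 0⟩, rfl, rfl, rfl, rfl⟩
  obtain ⟨k, k0, k1, k2, k3⟩ : ∃ k : ℍ, k.re = 0 ∧ k.imI = 0 ∧ k.imJ = 0 ∧ k.imK = 1 :=
    ⟨⟨0, 0, 0, 1⟩, rfl, rfl, rfl, rfl⟩
  let q : ℍ → ℍ := fun y => y - θ i * y * i - θ j * y * j - θ k * y * k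
  have hij : i * j = k := by ext <;> simp [i0, i1, i2, i3, j0, j1, j2, j3, k0, k1, k2, k3]
  have hji : j * i = -k := by ext <;> simp [i0, i1, i2, i3, j0, j1, j2, j3, k0, k1, k2, k3]
  have hjk : j * k = i := by ext <;> simp [i0, i1, i2, i3, j0, j1, j2, j3, k0, k1, k2, k3]
  have hkj : k * j = -i := by ext <;> simp [i0, i1, i2, i3, j0, j1, j2, j3, k0, k1, k2, k3]
  have hki : k * i = j := by ext <;> simp [i0, i1, i2, i3, j0, j1, j2, j3, k0, k1, k2, k3]
  have hik : i * k = -j := by ext <;> simp [i0, i1, i2, i3, j0, j1, j2, j3, k0, k1, k2, k3]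
  have hii : i * i = -1 := by ext <;> simp [i0, i1, i2, i3]
  have hjj : j * j = -1 := by ext <;> simp [j0, j1, j2, j3]
  have hkk : k * k = -1 := by ext <;> simp [k0, k1, k2, k3]
  have hneg : ∀ x, θ (-x) = -θ x := fun x => by
    have := hsmul (-1) x
    simpa using this
  have hqi : ∀ y, θ i * q y = q y * i := fun y => by
    simp only [q, mul_sub, sub_mul, ← mul_assoc]
    simp only [← hmul, hii, hij, hik, hneg, h1]
    simp only [mul_assoc, hii, hji, hki]
    simp
    abel
  have hqj : ∀ y, θ j * q y = q y * j := fun y => by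
    simp only [q, mul_sub, sub_mul, ← mul_assoc]
    simp only [← hmul, hjj, hji, hjk, hneg, h1]
    simp only [mul_assoc, hjj, hij, hkj]
    simp
    abel
  have hqk : ∀ y, θ k * q y = q y * k := fun y => by
    rw [← hij, hmul, mul_assoc, hqj, ← mul_assoc, hqi, mul_assoc]
  have hne : ∃ y, q y ≠ 0 := by
    by_contra! hq
    have h4 : q 1 - q i * i - q j * j - q k * k = ((4 : ℝ) : ℍ) := by
      simp only [q]
      generalize θ i = I
      generalize θ j = J
      generalize θ k = K
      ext <;> simp [i0, i1, i2, i3, j0, j1, j2, j3, k0, k1, k2, k3] <;> ring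
    simp only [hq] at h4
    have := congrArg QuaternionAlgebra.re h4
    simp at this
  obtain ⟨y, hy⟩ := hne
  refine ⟨q y, hy, fun x => ?_⟩
  have hx : x = x.re • (1 : ℍ) + x.imI • i + x.imJ • j + x.imK • k := by
    ext <;> simp [i0, i1, i2, i3, j0, j1, j2, j3, k0, k1, k2, k3]
  rw [hx]
  simp only [hadd, hsmul, h1, add_mul, mul_add, smul_mul_assoc, mul_smul_comm, hqi, hqj, hqk,
    one_mul, mul_one]

theorem smul_op_smul {n : ℕ} (v : Space ℍ n) (x y : ℍ) : v <• x <• y = v <• (x * y) := by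
  ext1 i
  simp [mul_assoc]

theorem eq_of_forall_op_smul {n : ℕ} [NeZero n] {x y : ℍ}
    (h : ∀ v : Space ℍ n, v <• x = v <• y) : x = y := by
  have := congrArg (fun w : Space ℍ n => w 0) (h (WithLp.toLp 2 fun _ => 1))
  simpa using this

theorem exists_hasSpFactor {n : ℕ} [NeZero n] (g : G ℍ n) :
    ∃ β, HasSpFactor (g : Space ℍ n ≃ₗᵢ[ℝ] Space ℍ n) β := by
  obtain ⟨φ, θ, -, h⟩ := g
  have key : ∀ x y : ℍ, (∀ v, φ v <• x = φ v <• y) → x = y := fun x y hxy =>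
    eq_of_forall_op_smul (n := n) fun v => by simpa using hxy (φ.symm v)
  have h1 : θ 1 = 1 := key _ _ fun v => by
    rw [← h]
    simp
  have hmul : ∀ x y, θ (x * y) = θ x * θ y := fun x y => key _ _ fun v => by
    rw [← h, ← smul_op_smul, h, h, smul_op_smul]
  obtain ⟨q, hq, hθq⟩ := exists_intertwiner θ (map_add θ) (map_smul θ) h1 hmul
  set u : ℍ := ‖q‖⁻¹ • q with hu
  have hn : ‖u‖ = 1 := by simp [hu, norm_smul, hq]
  have hθu : ∀ x, θ x * u = u * x := fun x => by simp [hu, hθq]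
  have hu0 : u ≠ 0 := by
    intro h0
    simp [h0] at hn
  let R : Space ℍ n ≃ₗᵢ[ℝ] Space ℍ n :=
    LinearIsometryEquiv.piLpCongrRight 2 fun _ => mulRight ⟨u, by simpa using hn⟩
  have hR : ∀ v, R v = v <• u := fun v => by
    ext1 i
    rfl
  refine ⟨⟨u⁻¹, by simp [hn]⟩, R * φ, fun v x => ?_, fun v => ?_⟩
  · change R (φ (v <• x)) = R (φ v) <• x
    rw [hR, hR, h, smul_op_smul, smul_op_smul, hθu]
  · change φ v = R (φ v) <• u⁻¹
    rw [hR, smul_op_smul, mul_inv_cancel₀ hu0]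
    simp

theorem HasSpFactor.mk_eq {n : ℕ} [NeZero n] {g : Space ℍ n ≃ₗᵢ[ℝ] Space ℍ n}
    {β γ : Metric.sphere (0 : ℍ) 1} (hβ : HasSpFactor g β) (hγ : HasSpFactor g γ) :
    (QuotientGroup.mk (mulRight β) : (ℍ ≃ₗᵢ[ℝ] ℍ) ⧸ signs) = QuotientGroup.mk (mulRight γ) := by
  obtain ⟨a, ha, hga⟩ := hβ
  obtain ⟨b, hb, hgb⟩ := hγ
  have hβ0 : (β : ℍ) ≠ 0 := ne_zero_of_mem_unit_sphere β
  obtain ⟨c, hc⟩ : ∃ c : ℍ, c = (γ : ℍ) * (β : ℍ)⁻¹ := ⟨_, rfl⟩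
  have hab : ∀ v, a v = b v <• c := fun v => by
    have := congrArg (fun w : Space ℍ n => w <• (β : ℍ)⁻¹) ((hga v).symm.trans (hgb v))
    simp only [smul_op_smul, mul_inv_cancel₀ hβ0] at this
    rw [hc, ← this]
    simp
  have hcomm : ∀ x, x * c = c * x := fun x =>
    eq_of_forall_op_smul (n := n) fun v => by
      obtain ⟨w, rfl⟩ := b.surjective v
      rw [← smul_op_smul, ← smul_op_smul, ← hb, ← hab, ← hab, ha]
  have hcn : ‖c‖ = 1 := by simp [hc]
  have hcr : c = (c.re : ℍ) := by
    obtain ⟨i, i0, i1, i2, i3⟩ : ∃ i : ℍ, i.re = 0 ∧ i.imI = 1 ∧ i.imJ = 0 ∧ i.imK = 0 :=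
      ⟨⟨0, 1, 0, 0⟩, rfl, rfl, rfl, rfl⟩
    obtain ⟨j, j0, j1, j2, j3⟩ : ∃ j : ℍ, j.re = 0 ∧ j.imI = 0 ∧ j.imJ = 1 ∧ j.imK = 0 :=
      ⟨⟨0, 0, 1, 0⟩, rfl, rfl, rfl, rfl⟩
    have hi := hcomm i
    have hj := hcomm j
    have e1 := congrArg QuaternionAlgebra.imK hi
    have e2 := congrArg QuaternionAlgebra.imJ hi
    have e3 := congrArg QuaternionAlgebra.imK hj
    simp [i0, i1, i2, i3, j0, j1, j2, j3] at e1 e2 e3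
    ext <;> simp <;> linarith
  have hγc : (γ : ℍ) = c * β := by simp [hc, hβ0]
  have hc1 : c = 1 ∨ c = -1 := by
    rw [hcr, Quaternion.norm_coe, Real.norm_eq_abs, abs_eq zero_le_one] at hcn
    rcases hcn with h | h
    · left
      rw [hcr, h]
      simp
    · right
      rw [hcr, h]
      simp
  rw [QuotientGroup.eq]
  rcases hc1 with h | h
  · left
    have : β = γ := Subtype.ext (by rw [hγc, h, one_mul])
    rw [this, inv_mul_cancel]
  · right
    rw [inv_mul_eq_iff_eq_mul]
    refine LinearIsometryEquiv.ext fun x => ?_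
    change x * (γ : ℍ) = -x * (β : ℍ)
    rw [hγc, h]
    simp

/-- `λ_ℍ(g)(x) = x β` for `g = (α, β) ∈ Sp(n) Sp(1)`.  As `β` is determined by `g` up to sign,
this is a projective representation, with values in `O(ℍ) / {1, -1}`. -/
def lambdaH (n : ℕ) [NeZero n] : G ℍ n →* (ℍ ≃ₗᵢ[ℝ] ℍ) ⧸ signs where
  toFun g := QuotientGroup.mk (mulRight (exists_hasSpFactor g).choose)
  map_one' := by
    have h1 : HasSpFactor ((1 : G ℍ n) : Space ℍ n ≃ₗᵢ[ℝ] Space ℍ n) 1 :=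
      ⟨1, one_mem _, fun v => by simp⟩
    rw [(exists_hasSpFactor (1 : G ℍ n)).choose_spec.mk_eq h1, ← QuotientGroup.mk_one]
    congr 1
    exact LinearIsometryEquiv.ext fun x => mul_one x
  map_mul' g h := by
    obtain ⟨a, ha, hga⟩ := (exists_hasSpFactor g).choose_spec
    obtain ⟨b, hb, hgb⟩ := (exists_hasSpFactor h).choose_spec
    have hgh : HasSpFactor ((g * h : G ℍ n) : Space ℍ n ≃ₗᵢ[ℝ] Space ℍ n)
        ((exists_hasSpFactor h).choose * (exists_hasSpFactor g).choose) := by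
      refine ⟨a * b, mul_mem ha hb, fun v => ?_⟩
      change g.1 (h.1 v) = _
      rw [hgb, hga, ha, smul_op_smul]
      rfl
    rw [(exists_hasSpFactor (g * h)).choose_spec.mk_eq hgh, ← QuotientGroup.mk_mul]
    congr 1
    exact LinearIsometryEquiv.ext fun x => (mul_assoc x _ _).symm

/-- The group of special twisted isomorphisms of `ℍⁿ`: those `g` for which the projective
transformation `λ_ℍ(g)` fixes `1`, that is, some representative of it fixes `1`. -/
def HH (n : ℕ) [NeZero n] : Subgroup (G ℍ n) where
  carrier := {g | ∃ L : ℍ ≃ₗᵢ[ℝ] ℍ, QuotientGroup.mk L = lambdaH n g ∧ L 1 = 1}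
  one_mem' := ⟨1, by simp, rfl⟩
  mul_mem' := by
    rintro a b ⟨L, hL, hL1⟩ ⟨M, hM, hM1⟩
    refine ⟨L * M, by rw [map_mul, ← hL, ← hM, QuotientGroup.mk_mul], ?_⟩
    simp [hL1, hM1]
  inv_mem' := by
    rintro a ⟨L, hL, hL1⟩
    refine ⟨L⁻¹, by rw [map_inv, ← hL, QuotientGroup.mk_inv], ?_⟩
    change L.symm 1 = 1
    rw [LinearIsometryEquiv.symm_apply_eq, hL1]

/-! ### The octonionic case -/

/-- The octonions, as pairs of quaternions with the Euclidean norm. -/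
def Octonion : Type := WithLp 2 (ℍ × ℍ)

namespace Octonion

instance : NormedAddCommGroup Octonion := inferInstanceAs (NormedAddCommGroup (WithLp 2 (ℍ × ℍ)))
instance : InnerProductSpace ℝ Octonion :=
  inferInstanceAs (InnerProductSpace ℝ (WithLp 2 (ℍ × ℍ)))

/-- The octonion `(a, b)`. -/
def mk (a b : ℍ) : Octonion := WithLp.toLp 2 (a, b)

/-- The first component of an octonion. -/
def fst (x : Octonion) : ℍ := (WithLp.ofLp x).1

/-- The second component of an octonion. -/
def snd (x : Octonion) : ℍ := (WithLp.ofLp x).2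

instance : One Octonion := ⟨mk 1 0⟩

/-- The Cayley-Dickson product `(a, b) (c, d) = (a c - d b*, a* d + c b)`. -/
instance : Mul Octonion :=
  ⟨fun x y => mk (x.fst * y.fst - y.snd * star x.snd) (star x.fst * y.snd + y.fst * x.snd)⟩

end Octonion

/-- The group of twisted isomorphisms of the octonionic line `𝕆`. -/
abbrev GO : Subgroup (Octonion ≃ₗᵢ[ℝ] Octonion) := twistedIso Octonion Octonion

/-- `λ_𝕆(g)(x) = g x`. -/
def lambdaO : GO →* (Octonion ≃ₗᵢ[ℝ] Octonion) := GO.subtype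

/-- The group of special twisted isomorphisms of `𝕆`. -/
def HO : Subgroup GO := stabOne lambdaO

/-- The compact group `G₂`: the automorphism group of the real algebra `𝕆`. -/
def G2 : Subgroup (Octonion ≃ₗ[ℝ] Octonion) where
  carrier := {φ | ∀ x y, φ (x * y) = φ x * φ y}
  one_mem' := fun _ _ => rfl
  mul_mem' := by
    intro φ ψ h k x y
    change φ (ψ (x * y)) = φ (ψ x) * φ (ψ y)
    rw [k, h]
  inv_mem' := by
    intro φ h x y
    change φ.symm (x * y) = φ.symm x * φ.symm y
    rw [LinearEquiv.symm_apply_eq, h]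
    simp

end NormedDivAlg

end


/-!
Right linear isometries of `Kⁿ` are exactly the actions of unitary matrices, since a Hermitian
matrix is determined by its quadratic form. Over `ℝ` and `ℂ` every twisted isomorphism is linear, so
fixing `1` means determinant `1`. Over `ℍ`, writing `g(v) = α(v) β`, fixing `1` up to sign means
`β = ±1`, that is, `g = ±α` is right linear.

An element of `GO` fixing `1` coincides with its twist `θ`, hence is an automorphism of `𝕆`.
Conversely an automorphism `φ` preserves the quadratic equation `x² = 2⟪x, 1⟫ x - ‖x‖²`, hence the
norm; what remains is `det φ = 1`. If `det φ = -1`, then `φ x = -x` for some unit `x`, necessarily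
imaginary, so `φ` anticommutes with the complex structure given by left multiplication by `x`.
Left multiplication by a unit imaginary `y ⟂ x` also anticommutes with it, so composing the two
gives a complex linear map. Real determinants of complex linear maps are nonnegative, and therefore
`det φ ≥ 0`, a contradiction.
-/

namespace NormedDivAlg

theorem exists_mulEquiv_of_eq_subgroupOf_range {S Γ : Type*} [Group S] [Group Γ] {G : Subgroup Γ}
    {H : Subgroup G} {f : S →* Γ} (hf : Function.Injective f) (hle : f.range ≤ G)
    (hH : H = f.range.subgroupOf G) : ∃ e : S ≃* H, ∀ s, (e s).1.1 = f s := by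
  subst hH
  exact ⟨(MonoidHom.ofInjective hf).trans (Subgroup.subgroupOfEquivOfLe hle).symm, fun _ => rfl⟩

theorem autGroup_le_twistedIso (A V : Type*) [NormedAddCommGroup A] [NormedSpace ℝ A]
    [NormedAddCommGroup V] [NormedSpace ℝ V] [SMul Aᵐᵒᵖ V] : autGroup A V ≤ twistedIso A V :=
  fun _ h => ⟨1, LinearMap.det_id, h⟩

section ComplexStructure

variable {V : Type*} [AddCommGroup V] [Module ℝ V] [FiniteDimensional ℝ V]
  {I J T : Module.End ℝ V}

theorem det_nonneg_of_commute (hJ : J * J = -1) (hTJ : Commute T J) : 0 ≤ LinearMap.det T := by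
  let action : ℂ →ₐ[ℝ] Module.End ℝ V := Complex.liftAux J hJ
  let _ : Module ℂ V := Module.compHom V action.toRingHom
  have smul_def (z : ℂ) (v : V) : z • v = z.re • v + z.im • J v := by
    change action z v = _
    simp [action, Complex.liftAux_apply, Algebra.algebraMap_eq_smul_one]
  have : IsScalarTower ℝ ℂ V := ⟨fun r z v => by simp [smul_def, mul_smul]⟩
  have : Module.Finite ℂ V := Module.Finite.of_restrictScalars_finite ℝ ℂ V
  let Tℂ : V →ₗ[ℂ] V :=
    { toFun := T
      map_add' := map_add T
      map_smul' z v := by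
        have : T (J v) = J (T v) := LinearMap.congr_fun hTJ v
        simp [smul_def, this] }
  calc 0 ≤ Complex.normSq (LinearMap.det Tℂ) := Complex.normSq_nonneg _
    _ = LinearMap.det T := by
      rw [← Algebra.norm_complex_apply, ← LinearMap.det_restrictScalars]
      rfl

theorem det_pos_of_mul_self_eq_neg_one (hJ : J * J = -1) : 0 < LinearMap.det J := by
  refine (det_nonneg_of_commute hJ (Commute.refl J)).lt_of_ne' fun h0 => ?_
  have hdet := congrArg LinearMap.det (show -(J * J) = 1 by rw [hJ, neg_neg])
  rw [← mul_neg, map_mul, h0, zero_mul, map_one] at hdet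
  exact zero_ne_one hdet

theorem det_nonneg_of_anticommute (hI : I * I = -1) (hJ : J * J = -1) (hIJ : I * J = -(J * I))
    (hTJ : T * J = -(J * T)) : 0 ≤ LinearMap.det T := by
  have hcomm : Commute (I * T) J :=
    calc I * T * J = -(I * J * T) := by rw [mul_assoc, hTJ, mul_neg, mul_assoc]
      _ = J * (I * T) := by rw [hIJ, neg_mul, neg_neg, mul_assoc]
  have hIT := det_nonneg_of_commute hJ hcomm
  rw [map_mul] at hIT
  exact nonneg_of_mul_nonneg_right hIT (det_pos_of_mul_self_eq_neg_one hI)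

end ComplexStructure

section Isometry

theorem det_adjoint {𝕜 E : Type*} [RCLike 𝕜] [NormedAddCommGroup E] [InnerProductSpace 𝕜 E]
    [FiniteDimensional 𝕜 E] (T : Module.End 𝕜 E) :
    LinearMap.det (LinearMap.adjoint T) = star (LinearMap.det T) := by
  let b := stdOrthonormalBasis 𝕜 E
  rw [← LinearMap.det_toMatrix b.toBasis, LinearMap.toMatrix_adjoint, Matrix.det_conjTranspose,
    LinearMap.det_toMatrix]

theorem exists_norm_eq_one_map_eq_neg {V : Type*} [NormedAddCommGroup V] [InnerProductSpace ℝ V]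
    [FiniteDimensional ℝ V] (φ : V ≃ₗᵢ[ℝ] V)
    (hφ : LinearMap.det (φ.toLinearEquiv : V →ₗ[ℝ] V) = -1) : ∃ x, ‖x‖ = 1 ∧ φ x = -x := by
  set T : Module.End ℝ V := (φ.toLinearEquiv : V →ₗ[ℝ] V)
  have hstar : star T = (φ.symm.toLinearEquiv : V →ₗ[ℝ] V) := φ.adjoint_toLinearMap_eq_symm
  have hT : T * star T = 1 := by
    rw [hstar]
    exact LinearMap.ext φ.apply_symm_apply
  have hdet : LinearMap.det (T + 1) = -LinearMap.det (T + 1) :=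
    calc LinearMap.det (T + 1) = LinearMap.det (T * star (T + 1)) := by
          rw [star_add, star_one, mul_add, hT, mul_one, add_comm]
      _ = -LinearMap.det (T + 1) := by
          rw [map_mul, hφ, LinearMap.star_eq_adjoint, det_adjoint, star_trivial, neg_one_mul]
  obtain ⟨x, hx, hx0⟩ := (Submodule.ne_bot_iff _).1
    (LinearMap.bot_lt_ker_of_det_eq_zero (self_eq_neg.1 hdet)).ne'
  have hφx : φ x = -x := eq_neg_of_add_eq_zero_left hx
  exact ⟨‖x‖⁻¹ • x, norm_smul_inv_norm (𝕜 := ℝ) hx0, by rw [map_smul, hφx, smul_neg]⟩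

theorem exists_norm_eq_one_forall_inner_eq_zero {𝕜 E ι : Type*} [RCLike 𝕜] [NormedAddCommGroup E]
    [InnerProductSpace 𝕜 E] [Fintype ι] (w : ι → E) (hcard : Fintype.card ι < Module.finrank 𝕜 E) :
    ∃ y : E, ‖y‖ = 1 ∧ ∀ i, inner 𝕜 y (w i) = 0 := by
  set U := Submodule.span 𝕜 (Set.range w)
  have hU : U ≠ ⊤ := fun h => by
    have hle : Module.finrank 𝕜 U ≤ Fintype.card ι := finrank_range_le_card w
    rw [h, finrank_top] at hle
    exact hcard.not_ge hle
  have : FiniteDimensional 𝕜 U := FiniteDimensional.span_of_finite 𝕜 (Set.finite_range w)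
  obtain ⟨y, hy, hy0⟩ :=
    Submodule.exists_mem_ne_zero_of_ne_bot (U.orthogonal_eq_bot_iff.not.2 hU)
  refine ⟨(‖y‖⁻¹ : 𝕜) • y, norm_smul_inv_norm hy0, fun i => ?_⟩
  exact Submodule.inner_left_of_mem_orthogonal (Submodule.subset_span (Set.mem_range_self i))
    (Uᗮ.smul_mem _ hy)

end Isometry

section UnitaryMatrices

open Matrix

variable {K : Type*} {ι : Type*} [Fintype ι]

theorem eq_zero_of_isHermitian_of_dotProduct_mulVec_eq_zero [Ring K] [StarRing K] [NoZeroDivisors K]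
    [CharZero K] {M : Matrix ι ι K} (hM : M.IsHermitian)
    (hform : ∀ v, star v ⬝ᵥ (M *ᵥ v) = 0) : M = 0 := by
  classical
  have hdiag (i : ι) : M i i = 0 := by simpa using hform (Pi.single i 1)
  ext i j
  have hpolar := hform (Pi.single i 1 + Pi.single j (M j i))
  simp only [mulVec_add, mulVec_single, star_add, dotProduct_add, add_dotProduct, hdiag,
    ← hM.apply j i, Pi.star_single, single_dotProduct, star_one, Pi.smul_apply, col_apply,
    MulOpposite.op_one, one_smul, MulOpposite.smul_eq_mul_unop, MulOpposite.unop_op, star_star,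
    one_mul, mul_zero, zero_mul, zero_add, add_zero, add_self_eq_zero, mul_eq_zero, star_eq_zero,
    or_self] at hpolar
  simpa using hpolar

variable [NormedDivisionRing K] [NormedAlgebra ℝ K]

/-- The matrix whose `j`-th column is the image under `φ` of the `j`-th standard basis vector. -/
def columnMatrix [DecidableEq ι] (φ : EuclideanSpace K ι → EuclideanSpace K ι) :
    Matrix ι ι K :=
  Matrix.of fun i j => φ (WithLp.toLp 2 (Pi.single j 1)) i

theorem toLp_columnMatrix_mulVec [DecidableEq ι]
    {φ : EuclideanSpace K ι ≃ₗᵢ[ℝ] EuclideanSpace K ι}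
    (hφ : φ ∈ autGroup K (EuclideanSpace K ι)) (v : EuclideanSpace K ι) :
    WithLp.toLp 2 (columnMatrix φ *ᵥ v.ofLp) = φ v := by
  have hmap (w : EuclideanSpace K ι) (x : K) : φ (w <• x) = φ w <• x := hφ w x
  have hv : v = ∑ j, (WithLp.toLp 2 (Pi.single j 1) : EuclideanSpace K ι) <• v j := by
    ext i
    simp [Pi.single_apply]
  conv_rhs => rw [hv, map_sum]
  ext i
  simp [hmap, columnMatrix, mulVec, dotProduct]

/-- Real normed division algebras with an involution satisfying `x* x = ‖x‖²`, that is, `ℝ`, `ℂ`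
and `ℍ` with their conjugations: this is what makes unitary matrices act isometrically. -/
class StarMulSelfEqNormSq (K : Type*) [NormedDivisionRing K] [NormedAlgebra ℝ K] [StarRing K] :
    Prop where
  star_mul_self_eq_norm_sq (x : K) : star x * x = algebraMap ℝ K (‖x‖ ^ 2)

instance {𝕜 : Type*} [RCLike 𝕜] : StarMulSelfEqNormSq 𝕜 where
  star_mul_self_eq_norm_sq x := by simpa using RCLike.conj_mul x

instance : StarMulSelfEqNormSq ℍ where
  star_mul_self_eq_norm_sq x := by
    rw [Quaternion.star_mul_self, Quaternion.normSq_eq_norm_mul_self, sq]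
    rfl

variable [StarRing K] [StarMulSelfEqNormSq K]

theorem star_dotProduct_self (v : ι → K) :
    star v ⬝ᵥ v = algebraMap ℝ K (‖(WithLp.toLp 2 v : EuclideanSpace K ι)‖ ^ 2) := by
  rw [PiLp.norm_sq_eq_of_L2, map_sum]
  exact Finset.sum_congr rfl fun i _ => StarMulSelfEqNormSq.star_mul_self_eq_norm_sq (v i)

theorem star_mul_self_eq_one_iff [DecidableEq ι] {A : Matrix ι ι K} :
    star A * A = 1 ↔ ∀ v : ι → K, ‖(WithLp.toLp 2 (A *ᵥ v) : EuclideanSpace K ι)‖ =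
      ‖(WithLp.toLp 2 v : EuclideanSpace K ι)‖ := by
  have : CharZero K := charZero_of_injective_algebraMap (algebraMap ℝ K).injective
  have hform (v : ι → K) :
      star v ⬝ᵥ ((star A * A) *ᵥ v) =
        algebraMap ℝ K (‖(WithLp.toLp 2 (A *ᵥ v) : EuclideanSpace K ι)‖ ^ 2) := by
    rw [← star_dotProduct_self, star_mulVec, ← dotProduct_mulVec, mulVec_mulVec,
      star_eq_conjTranspose]
  refine ⟨fun hA v => ?_, fun hA => sub_eq_zero.1 ?_⟩
  · have := hform v
    rw [hA, one_mulVec, star_dotProduct_self, (algebraMap ℝ K).injective.eq_iff,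
      sq_eq_sq₀ (norm_nonneg _) (norm_nonneg _)] at this
    exact this.symm
  · refine eq_zero_of_isHermitian_of_dotProduct_mulVec_eq_zero
      ((isHermitian_conjTranspose_mul_self A).sub isHermitian_one) fun v => ?_
    rw [sub_mulVec, one_mulVec, dotProduct_sub, hform, hA, star_dotProduct_self, sub_self]

variable [DecidableEq ι]

variable (K ι) in
/-- The action `v ↦ A v` of the unitary matrices on column vectors. -/
noncomputable def unitaryAction :
    unitary (Matrix ι ι K) →* (EuclideanSpace K ι ≃ₗᵢ[ℝ] EuclideanSpace K ι) where
  toFun A :=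
    { toFun v := WithLp.toLp 2 (A.1 *ᵥ v.ofLp)
      invFun v := WithLp.toLp 2 (star A.1 *ᵥ v.ofLp)
      map_add' v w := by simp [mulVec_add]
      map_smul' r v := by simp [mulVec_smul]
      left_inv v := by simp [mulVec_mulVec, Unitary.star_mul_self_of_mem A.2]
      right_inv v := by simp [mulVec_mulVec, Unitary.mul_star_self_of_mem A.2]
      norm_map' v := star_mul_self_eq_one_iff.1 (Unitary.star_mul_self_of_mem A.2) v.ofLp }
  map_one' := LinearIsometryEquiv.ext fun v => congrArg (WithLp.toLp 2) (one_mulVec v.ofLp)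
  map_mul' A B := LinearIsometryEquiv.ext fun v =>
    congrArg (WithLp.toLp 2) (mulVec_mulVec v.ofLp A.1 B.1).symm

theorem unitaryAction_apply (A : unitary (Matrix ι ι K)) (v : EuclideanSpace K ι) :
    unitaryAction K ι A v = WithLp.toLp 2 (A.1 *ᵥ v.ofLp) := rfl

theorem unitaryAction_injective : Function.Injective (unitaryAction K ι) := fun A B hAB =>
  Subtype.ext <| ext_of_mulVec_single fun i => by
    have := LinearIsometryEquiv.congr_fun hAB (WithLp.toLp 2 (Pi.single i 1))
    exact congrArg WithLp.ofLp this

theorem range_unitaryAction :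
    (unitaryAction K ι).range = autGroup K (EuclideanSpace K ι) := by
  ext φ
  constructor
  · rintro ⟨A, rfl⟩ v x
    ext i
    simp [unitaryAction_apply, mulVec, dotProduct, Finset.sum_mul, mul_assoc]
  · intro hφ
    have hunitary : star (columnMatrix φ) * columnMatrix φ = 1 :=
      star_mul_self_eq_one_iff.2 fun v => by
        rw [toLp_columnMatrix_mulVec hφ (WithLp.toLp 2 v), φ.norm_map]
    exact ⟨⟨columnMatrix φ, Unitary.mem_iff.2 ⟨hunitary, mul_eq_one_comm.1 hunitary⟩⟩,
      LinearIsometryEquiv.ext fun v => toLp_columnMatrix_mulVec hφ v⟩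

end UnitaryMatrices

section SpecialUnitary

open Matrix

variable {𝕜 : Type*} [RCLike 𝕜] {ι : Type*} [Fintype ι] [DecidableEq ι]

variable (𝕜 ι) in
/-- The action `v ↦ A v` of the unitary matrices of determinant `1` on column vectors: for `𝕜 = ℝ`
these are the matrices in `SO(n)`. -/
noncomputable def specialUnitaryAction :
    specialUnitaryGroup ι 𝕜 →* (EuclideanSpace 𝕜 ι ≃ₗᵢ[ℝ] EuclideanSpace 𝕜 ι) :=
  (unitaryAction 𝕜 ι).comp (Submonoid.inclusion specialUnitaryGroup_le_unitaryGroup)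

theorem specialUnitaryAction_injective : Function.Injective (specialUnitaryAction 𝕜 ι) :=
  unitaryAction_injective.comp (Submonoid.inclusion_injective _)

theorem range_specialUnitaryAction_le :
    (specialUnitaryAction 𝕜 ι).range ≤ autGroup 𝕜 (EuclideanSpace 𝕜 ι) := by
  rw [← range_unitaryAction]
  rintro _ ⟨A, rfl⟩
  exact ⟨_, rfl⟩

theorem mem_range_specialUnitaryAction_iff (f : EuclideanSpace 𝕜 ι →ₗ[𝕜] EuclideanSpace 𝕜 ι)
    {φ : EuclideanSpace 𝕜 ι ≃ₗᵢ[ℝ] EuclideanSpace 𝕜 ι} (hf : ∀ v, f v = φ v) :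
    φ ∈ (specialUnitaryAction 𝕜 ι).range ↔ LinearMap.det f = 1 := by
  have hdet (A : unitary (Matrix ι ι 𝕜)) (hA : unitaryAction 𝕜 ι A = φ) :
      LinearMap.det f = A.1.det := by
    rw [← LinearMap.det_toLpLin 2 A.1]
    exact congrArg _ (LinearMap.ext fun v => (hf v).trans (LinearIsometryEquiv.congr_fun hA v).symm)
  constructor
  · rintro ⟨A, hA⟩
    exact (hdet _ hA).trans (mem_specialUnitaryGroup_iff.1 A.2).2
  · intro hf1
    have hφ : φ ∈ autGroup 𝕜 (EuclideanSpace 𝕜 ι) := fun v x => by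
      have hop (w : EuclideanSpace 𝕜 ι) : w <• x = x • w := PiLp.ext fun i => mul_comm _ _
      rw [hop, hop, ← hf, ← hf, map_smul]
    obtain ⟨A, hA⟩ := range_unitaryAction.ge hφ
    exact ⟨⟨A.1, mem_specialUnitaryGroup_iff.2 ⟨A.2, (hdet A hA).symm.trans hf1⟩⟩, hA⟩

theorem HR_eq_subgroupOf (n : ℕ) :
    HR n = (specialUnitaryAction ℝ (Fin n)).range.subgroupOf (G ℝ n) := by
  ext g
  have hstab : g ∈ HR n ↔
      1 * LinearMap.det (g.1.toLinearEquiv : Space ℝ n →ₗ[ℝ] Space ℝ n) = 1 := Iff.rfl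
  rw [hstab, one_mul, Subgroup.mem_subgroupOf, mem_range_specialUnitaryAction_iff _ fun _ => rfl]

theorem HC_eq_subgroupOf (n : ℕ) :
    HC n = (specialUnitaryAction ℂ (Fin n)).range.subgroupOf (G ℂ n) := by
  ext g
  have hstab : g ∈ HC n ↔ 1 * LinearMap.det (toComplexLinear g) = 1 := Iff.rfl
  rw [hstab, one_mul, Subgroup.mem_subgroupOf,
    mem_range_specialUnitaryAction_iff (toComplexLinear g) fun _ => rfl]

end SpecialUnitary

section Quaternionic

theorem lambdaH_eq_mk {n : ℕ} [NeZero n] {g : G ℍ n} {β : Metric.sphere (0 : ℍ) 1}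
    (hβ : HasSpFactor g.1 β) : lambdaH n g = QuotientGroup.mk (mulRight β) :=
  (exists_hasSpFactor g).choose_spec.mk_eq hβ

theorem eq_one_or_eq_neg_one_of_mem_HH {n : ℕ} [NeZero n] {g : G ℍ n} (hg : g ∈ HH n)
    {β : Metric.sphere (0 : ℍ) 1} (hβ : HasSpFactor g.1 β) : (β : ℍ) = 1 ∨ (β : ℍ) = -1 := by
  obtain ⟨L, hL, hL1⟩ := hg
  rw [lambdaH_eq_mk hβ, QuotientGroup.eq] at hL
  have hβ1 : mulRight β 1 = β := one_mul _
  rcases hL with hL | hL <;> rw [inv_mul_eq_iff_eq_mul] at hL <;> rw [← hβ1, hL]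
  · exact Or.inl hL1
  · exact Or.inr ((map_neg L 1).trans (congrArg _ hL1))

theorem HH_eq_subgroupOf (n : ℕ) [NeZero n] :
    HH n = (unitaryAction ℍ (Fin n)).range.subgroupOf (G ℍ n) := by
  ext g
  rw [Subgroup.mem_subgroupOf, range_unitaryAction]
  constructor
  · intro hg
    obtain ⟨β, α, hα, hgα⟩ := exists_hasSpFactor g
    have hαx (v : Space ℍ n) (x : ℍ) : α (v <• x) = α v <• x := hα v x
    intro v x
    rcases eq_one_or_eq_neg_one_of_mem_HH hg ⟨α, hα, hgα⟩ with hβ | hβ <;>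
      simp [hgα, hβ, hαx]
  · intro hg
    have hβ : HasSpFactor g.1 1 := ⟨g.1, hg, fun v => (one_smul _ _).symm⟩
    exact ⟨mulRight 1, (lambdaH_eq_mk hβ).symm, one_mul _⟩

end Quaternionic

namespace Octonion

@[ext]
theorem ext {x y : Octonion} (hfst : x.fst = y.fst) (hsnd : x.snd = y.snd) : x = y :=
  WithLp.ofLp_injective 2 (Prod.ext hfst hsnd)

@[simp] theorem fst_add (x y : Octonion) : (x + y).fst = x.fst + y.fst := rfl
@[simp] theorem snd_add (x y : Octonion) : (x + y).snd = x.snd + y.snd := rfl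
@[simp] theorem fst_sub (x y : Octonion) : (x - y).fst = x.fst - y.fst := rfl
@[simp] theorem snd_sub (x y : Octonion) : (x - y).snd = x.snd - y.snd := rfl
@[simp] theorem fst_neg (x : Octonion) : (-x).fst = -x.fst := rfl
@[simp] theorem snd_neg (x : Octonion) : (-x).snd = -x.snd := rfl
@[simp] theorem fst_zero : (0 : Octonion).fst = 0 := rfl
@[simp] theorem snd_zero : (0 : Octonion).snd = 0 := rfl
@[simp] theorem fst_smul (r : ℝ) (x : Octonion) : (r • x).fst = r • x.fst := rfl
@[simp] theorem snd_smul (r : ℝ) (x : Octonion) : (r • x).snd = r • x.snd := rfl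
@[simp] theorem fst_one : (1 : Octonion).fst = 1 := rfl
@[simp] theorem snd_one : (1 : Octonion).snd = 0 := rfl
@[simp] theorem fst_mul (x y : Octonion) :
    (x * y).fst = x.fst * y.fst - y.snd * star x.snd := rfl
@[simp] theorem snd_mul (x y : Octonion) :
    (x * y).snd = star x.fst * y.snd + y.fst * x.snd := rfl

noncomputable instance : NonAssocRing Octonion where
  __ := (inferInstance : AddCommGroup Octonion)
  zero_mul x := by ext1 <;> simp
  mul_zero x := by ext1 <;> simp
  one_mul x := by ext1 <;> simp
  mul_one x := by ext1 <;> simp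
  left_distrib x y z := by ext1 <;> simp [mul_add, add_mul] <;> abel
  right_distrib x y z := by ext1 <;> simp [mul_add, add_mul] <;> abel

instance : SMulCommClass ℝ Octonion Octonion where
  smul_comm r x y := by ext1 <;> simp [smul_sub]

instance : Nontrivial Octonion := inferInstanceAs (Nontrivial (WithLp 2 (ℍ × ℍ)))

instance : FiniteDimensional ℝ Octonion :=
  inferInstanceAs (FiniteDimensional ℝ (WithLp 2 (ℍ × ℍ)))

theorem finrank_eq_eight : Module.finrank ℝ Octonion = 8 := by
  have e : Octonion ≃ₗ[ℝ] ℍ × ℍ := WithLp.linearEquiv 2 ℝ (ℍ × ℍ)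
  rw [e.finrank_eq, Module.finrank_prod, Quaternion.finrank_eq_four]

theorem inner_def (x y : Octonion) :
    inner ℝ x y = inner ℝ x.fst y.fst + inner ℝ x.snd y.snd := rfl

theorem inner_one_right (x : Octonion) : inner ℝ x 1 = x.fst.re := by
  simp [inner_def, Quaternion.inner_def]

theorem mul_self_eq (x : Octonion) : x * x = (2 * inner ℝ x 1) • x - (‖x‖ ^ 2) • 1 := by
  rw [← real_inner_self_eq_norm_sq, inner_one_right, inner_def, Quaternion.inner_self,
    Quaternion.inner_self]
  ext <;> simp [Quaternion.normSq_def'] <;> ring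

theorem mulLeft_mul_mulLeft_add {x y : Octonion} (hx : inner ℝ x 1 = 0) (hy : inner ℝ y 1 = 0) :
    LinearMap.mulLeft ℝ x * LinearMap.mulLeft ℝ y + LinearMap.mulLeft ℝ y * LinearMap.mulLeft ℝ x =
      -((2 * inner ℝ x y) • 1) := by
  rw [inner_one_right] at hx hy
  refine LinearMap.ext fun z => ?_
  change x * (y * z) + y * (x * z) = -((2 * inner ℝ x y) • z)
  rw [inner_def]
  ext <;> simp [Quaternion.inner_def, hx, hy] <;> ring

theorem mulLeft_mul_self {x : Octonion} (hx : inner ℝ x 1 = 0) (hnorm : ‖x‖ = 1) :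
    LinearMap.mulLeft ℝ x * LinearMap.mulLeft ℝ x = -1 := by
  have h := mulLeft_mul_mulLeft_add hx hx
  rwa [real_inner_self_eq_norm_sq, hnorm, one_pow, mul_smul, one_smul, ← two_smul ℝ, ← smul_neg,
    smul_right_inj two_ne_zero] at h

theorem mulLeft_anticommute {x y : Octonion} (hx : inner ℝ x 1 = 0) (hy : inner ℝ y 1 = 0)
    (hxy : inner ℝ x y = 0) :
    LinearMap.mulLeft ℝ x * LinearMap.mulLeft ℝ y =
      -(LinearMap.mulLeft ℝ y * LinearMap.mulLeft ℝ x) := by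
  rw [eq_neg_iff_add_eq_zero, mulLeft_mul_mulLeft_add hx hy, hxy, mul_zero, zero_smul, neg_zero]

theorem norm_sq_eq_of_mul_self_eq {x : Octonion} (hx : LinearIndependent ℝ ![1, x]) {a b : ℝ}
    (h : x * x = a • x - b • 1) : ‖x‖ ^ 2 = b := by
  have hcomb : (b - ‖x‖ ^ 2) • 1 + (2 * inner ℝ x 1 - a) • x = 0 := by
    rw [mul_self_eq] at h
    linear_combination (norm := module) h
  exact (sub_eq_zero.1 (LinearIndependent.pair_iff.1 hx _ _ hcomb).1).symm

theorem det_eq_one_of_map_mul (φ : Octonion ≃ₗᵢ[ℝ] Octonion)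
    (hmul : ∀ x y, φ (x * y) = φ x * φ y) :
    LinearMap.det (φ.toLinearEquiv : Octonion →ₗ[ℝ] Octonion) = 1 := by
  have h1 : φ 1 = 1 := _root_.map_one (MulEquiv.mk φ.toEquiv hmul)
  have hdet := norm_det_eq_one (φ.toLinearEquiv : Octonion →ₗ[ℝ] Octonion) φ.norm_map
  rw [mem_sphere_zero_iff_norm, Real.norm_eq_abs, abs_eq zero_le_one] at hdet
  refine hdet.resolve_right fun hneg => ?_
  obtain ⟨x, hxnorm, hφx⟩ := exists_norm_eq_one_map_eq_neg φ hneg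
  have hx : inner ℝ x 1 = 0 := by
    have := φ.inner_map_map x 1
    rwa [h1, hφx, inner_neg_left, neg_eq_self] at this
  obtain ⟨y, hynorm, hperp⟩ :=
    exists_norm_eq_one_forall_inner_eq_zero (𝕜 := ℝ) ![1, x] (by simp [finrank_eq_eight])
  have hy : inner ℝ y 1 = 0 := hperp 0
  have hyx : inner ℝ y x = 0 := hperp 1
  have hanti : (φ.toLinearEquiv : Module.End ℝ Octonion) * LinearMap.mulLeft ℝ x =
      -(LinearMap.mulLeft ℝ x * (φ.toLinearEquiv : Module.End ℝ Octonion)) :=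
    LinearMap.ext fun v => by
      change φ (x * v) = -(x * φ v)
      rw [hmul, hφx, neg_mul]
  have := det_nonneg_of_anticommute (mulLeft_mul_self hy hynorm) (mulLeft_mul_self hx hxnorm)
    (mulLeft_anticommute hy hx hyx) hanti
  linarith

end Octonion

namespace G2

protected theorem map_one {φ : Octonion ≃ₗ[ℝ] Octonion} (hφ : φ ∈ G2) : φ 1 = 1 :=
  _root_.map_one (MulEquiv.mk φ.toEquiv hφ)

protected theorem norm_map {φ : Octonion ≃ₗ[ℝ] Octonion} (hφ : φ ∈ G2) (x : Octonion) :
    ‖φ x‖ = ‖x‖ := by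
  by_cases hx : LinearIndependent ℝ ![1, φ x]
  · have hquad : φ x * φ x = (2 * inner ℝ x 1) • φ x - (‖x‖ ^ 2) • 1 := by
      rw [← hφ, Octonion.mul_self_eq, map_sub, map_smul, map_smul, G2.map_one hφ]
    have hsq := Octonion.norm_sq_eq_of_mul_self_eq hx hquad
    exact (sq_eq_sq₀ (norm_nonneg _) (norm_nonneg _)).1 hsq
  · simp only [LinearIndependent.pair_iff' one_ne_zero, not_forall, not_not] at hx
    obtain ⟨r, hr⟩ := hx
    have : x = r • 1 := φ.injective (by rw [← hr, map_smul, G2.map_one hφ])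
    rw [← hr, ← this]

/-- The action of `G₂` on `𝕆` by isometries. -/
noncomputable def toIsometry : G2 →* (Octonion ≃ₗᵢ[ℝ] Octonion) where
  toFun φ := ⟨φ.1, G2.norm_map φ.2⟩
  map_one' := rfl
  map_mul' _ _ := rfl

theorem toIsometry_injective : Function.Injective toIsometry := fun _ _ h =>
  Subtype.ext (congrArg LinearIsometryEquiv.toLinearEquiv h)

theorem mem_range_toIsometry_iff {φ : Octonion ≃ₗᵢ[ℝ] Octonion} :
    φ ∈ toIsometry.range ↔ ∀ x y, φ (x * y) = φ x * φ y :=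
  ⟨by rintro ⟨ψ, rfl⟩; exact ψ.2, fun hφ => ⟨⟨φ.toLinearEquiv, hφ⟩, rfl⟩⟩

theorem range_toIsometry_le : toIsometry.range ≤ GO := fun φ hφ =>
  have hmul := mem_range_toIsometry_iff.1 hφ
  ⟨φ, Octonion.det_eq_one_of_map_mul φ hmul, hmul⟩

end G2

theorem HO_eq_subgroupOf : HO = G2.toIsometry.range.subgroupOf GO := by
  ext g
  rw [Subgroup.mem_subgroupOf]
  constructor
  · intro (hg : g.1 1 = 1)
    obtain ⟨θ, -, hθ⟩ := g.2
    have hgθ (x : Octonion) : g.1 x = θ x :=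
      calc g.1 x = g.1 (1 * x) := by rw [one_mul]
        _ = g.1 1 * θ x := hθ 1 x
        _ = θ x := by rw [hg, one_mul]
    exact G2.mem_range_toIsometry_iff.2 fun x y => by rw [hgθ y]; exact hθ x y
  · rintro ⟨φ, hφ⟩
    change g.1 1 = 1
    rw [← hφ]
    exact G2.map_one φ.2

end NormedDivAlg

theorem mainTheorem3 :
    (∀ n : ℕ, ∃ e : Matrix.specialOrthogonalGroup (Fin n) ℝ ≃* NormedDivAlg.HR n,
      ∀ (A : Matrix.specialOrthogonalGroup (Fin n) ℝ) (v : NormedDivAlg.Space ℝ n),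
        (e A).1.1 v = WithLp.toLp 2 (A.1.mulVec v.ofLp)) ∧
    (∀ n : ℕ, ∃ e : Matrix.specialUnitaryGroup (Fin n) ℂ ≃* NormedDivAlg.HC n,
      ∀ (A : Matrix.specialUnitaryGroup (Fin n) ℂ) (v : NormedDivAlg.Space ℂ n),
        (e A).1.1 v = WithLp.toLp 2 (A.1.mulVec v.ofLp)) ∧
    (∀ (n : ℕ) [NeZero n], ∃ e : NormedDivAlg.Sp n ≃* NormedDivAlg.HH n,
      ∀ (A : NormedDivAlg.Sp n) (v : NormedDivAlg.Space ℍ n),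
        (e A).1.1 v = WithLp.toLp 2 (A.1.mulVec v.ofLp)) ∧
    (∃ e : NormedDivAlg.G2 ≃* NormedDivAlg.HO,
      ∀ (φ : NormedDivAlg.G2) (x : NormedDivAlg.Octonion), (e φ).1.1 x = φ.1 x) := by
  open NormedDivAlg in
  refine ⟨fun n => ?_, fun n => ?_, fun n _ => ?_, ?_⟩
  · obtain ⟨e, he⟩ := exists_mulEquiv_of_eq_subgroupOf_range specialUnitaryAction_injective
      (range_specialUnitaryAction_le.trans (autGroup_le_twistedIso _ _)) (HR_eq_subgroupOf n)
    exact ⟨e, fun A v => congrArg (· v) (he A)⟩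
  · obtain ⟨e, he⟩ := exists_mulEquiv_of_eq_subgroupOf_range specialUnitaryAction_injective
      (range_specialUnitaryAction_le.trans (autGroup_le_twistedIso _ _)) (HC_eq_subgroupOf n)
    exact ⟨e, fun A v => congrArg (· v) (he A)⟩
  · obtain ⟨e, he⟩ := exists_mulEquiv_of_eq_subgroupOf_range unitaryAction_injective
      (range_unitaryAction.le.trans (autGroup_le_twistedIso _ _)) (HH_eq_subgroupOf n)
    exact ⟨e, fun A v => congrArg (· v) (he A)⟩
  · obtain ⟨e, he⟩ := exists_mulEquiv_of_eq_subgroupOf_range G2.toIsometry_injective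
      G2.range_toIsometry_le HO_eq_subgroupOf
    exact ⟨e, fun φ x => congrArg (· x) (he φ)⟩
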